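/- Write $\mathfrak c=2^{\aleph_0}$, and for $t\in 2^{<\kappa}$ let $l(t)$ be its length; $2^{<\kappa}$ is ordered by end-extension. A set $T\subseteq 2^{<\kappa}$ is an \emph{acceptable tree} if $\emptyset\in T$; every $t\in T\setminus\{\emptyset\}$ has successor length; every initial segment of successor length of an element of $T$ is in $T$; and for every $t\in 2^{<\kappa}$, $t^\frown 0\in T$ if and only if $t^\frown 1\in T$. A branch of $T$ is a maximal chain in $T$; it is cofinal if it contains nodes of arbitrarily large length below $\kappa$. An acceptable tree $T\subseteq 2^{<\kappa}$ is \emph{$\kappa$-Kurepa} if it has height $\kappa$, all its levels have size $<\kappa$, and it has more than $\kappa$ cofinal branches. For a Boolean algebra $A\subseteq\mathcal P(\omega)$, an ultrafilter $u$ on $A$ and $x\subseteq\omega$, say that $x$ is \emph{minimal for} $(A,u)$ if $u$ is the unique ultrafilter on $A$ which does not generate an ultrafilter on the Boolean algebra generated by $A\cup\{x\}$. Let $T$ be an acceptable tree. A Boolean algebra $\mathcal A\subseteq\mathcal P(\omega)$ is a \emph{$T$-algebra} if it is generated by the finite subsets of $\omega$ together with a family $\{a_t:t\in T\}$ of infinite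 subsets of $\omega$ such that $a_\emptyset=\omega$; $a_{t^\frown 1}=\omega\setminus a_{t^\frown 0}$ whenever $t^\frown 0,t^\frown 1\in T$; for every $t\in T$ all intersections of finitely many members of $\{a_s:s\in T,\,s<t\}$ are infinite; and, for every $t\in T\setminus\{\emptyset\}$, $a_t$ is minimal for $(A_t,u_t)$, where $A_t$ is the Boolean algebra generated by the finite sets and $\{a_s:s\in T,\,s<t\}$, and $u_t$ is the ultrafilter on $A_t$ generated by the cofinite sets and $\{a_s:s\in T,\,s<t\}$. The Stone space $St(\mathcal A)$ is the set of ultrafilters on $\mathcal A$ with the topology with base $\{\{u: a\in u\}:a\in\mathcal A\}$. \textbf{Statement.} (1) Let $K\subseteq 2^{<\mathfrak c}$ be an acceptable $\mathfrak c$-Kurepa tree and let $\mathcal A$ be any $K$-algebra. Then $St(\mathcal A)$ is sequentially compact; moreover, it is separable and has cardinality greater than $\mathfrak c$. (2) If $\diamondsuit^+(\mathfrak c)$ holds, then there is an acceptable $\mathfrak c$-Kurepa tree $K\subseteq 2^{<\mathfrak c}$. Here, for a regular uncountable cardinal $\kappa$ (so the hypothesis includes that $\mathfrak c$ is regular), $\diamondsuit^+(\kappa)$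 says that there are families $S_\alpha\subseteq\mathcal P(\alpha)$ $(\alpha<\kappa)$ with $|S_\alpha|\le|\alpha|+\aleph_0$ such that for every $X\subseteq\kappa$ there is a closed unbounded $C\subseteq\kappa$ with $X\cap\alpha\in S_\alpha$ and $C\cap\alpha\in S_\alpha$ for all $\alpha\in C$. -/

import Mathlib

namespace TAlg

open Set Cardinal

/-! ### Binary sequences of ordinal length -/

/-- A binary sequence of ordinal length `len`, i.e. a function `len → 2`. It is coded as a function
on all ordinals which takes the value `false` (that is, `0`) outside `len`, so that two sequences
are equal iff they have the same length and the same values below it. -/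
@[ext]
structure BinSeq : Type 1 where
  len : Ordinal.{0}
  val : Ordinal.{0} → Bool
  val_of_le : ∀ α, len ≤ α → val α = false

/-- The order by end-extension: `s ≤ t` iff `s` is an initial segment of `t`. -/
instance : PartialOrder BinSeq where
  le s t := s.len ≤ t.len ∧ ∀ α < s.len, s.val α = t.val α
  le_refl s := ⟨le_rfl, fun _ _ => rfl⟩
  le_trans r s t h h' :=
    ⟨h.1.trans h'.1, fun α hα => (h.2 α hα).trans (h'.2 α (hα.trans_le h.1))⟩
  le_antisymm s t h h' := by
    have hl : s.len = t.len := le_antisymm h.1 h'.1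
    refine BinSeq.ext hl (funext fun α => ?_)
    rcases lt_or_ge α s.len with hα | hα
    · exact h.2 α hα
    · rw [s.val_of_le α hα, t.val_of_le α (hl ▸ hα)]

/-- The empty sequence. -/
def BinSeq.empty : BinSeq := ⟨0, fun _ => false, fun _ _ => rfl⟩

open Classical in
/-- The sequence `t⌢i`: the sequence `t` followed by the single digit `i`. -/
noncomputable def BinSeq.snoc (t : BinSeq) (i : Bool) : BinSeq where
  len := t.len + 1
  val := fun α => if α = t.len then i else t.val α
  val_of_le := fun α hα => by
    have h : t.len < α := lt_of_lt_of_le (Order.lt_add_one_iff.mpr le_rfl) hα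
    rw [if_neg h.ne', t.val_of_le α h.le]

/-! ### Trees -/

/-- `T` is an acceptable subtree of `2^{<κ}`. The root `∅` belongs to `T`, every other node has
successor length, `T` is closed under initial segments of successor length, and of the two
one-digit extensions of a sequence either both or none belong to `T`. -/
structure IsAcceptable (κ : Cardinal.{0}) (T : Set BinSeq) : Prop where
  len_lt : ∀ t ∈ T, t.len < κ.ord
  empty_mem : BinSeq.empty ∈ T
  len_succ : ∀ t ∈ T, t ≠ BinSeq.empty → ∃ α, t.len = α + 1
  initial_mem : ∀ s ∈ T, ∀ r ≤ s, (∃ α, r.len = α + 1) → r ∈ T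
  snoc_mem_iff : ∀ t : BinSeq, t.snoc false ∈ T ↔ t.snoc true ∈ T

/-- A branch of `T` is a maximal chain in `T`. -/
def IsBranch (T b : Set BinSeq) : Prop :=
  Maximal (fun c : Set BinSeq => c ⊆ T ∧ IsChain (· ≤ ·) c) b

/-- A branch of a subtree of `2^{<κ}` is cofinal if it has nodes of arbitrarily large
length below `κ`. -/
def IsCofinalBranch (κ : Cardinal.{0}) (T b : Set BinSeq) : Prop :=
  IsBranch T b ∧ ∀ α < κ.ord, ∃ t ∈ b, α < t.len

/-- `T` is an acceptable `κ`-Kurepa tree: an acceptable subtree of `2^{<κ}` of height `κ`, with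
levels of size `< κ` and more than `κ` many cofinal branches. (In an acceptable tree the nodes of
any given level are exactly the nodes of some given length.) -/
structure IsAcceptableKurepa (κ : Cardinal.{0}) (T : Set BinSeq) : Prop where
  acceptable : IsAcceptable κ T
  height : ∀ α < κ.ord, ∃ t ∈ T, α < t.len
  level_lt : ∀ α < κ.ord, #{t : BinSeq // t ∈ T ∧ t.len = α} < Cardinal.lift.{1} κ
  lt_branches : Cardinal.lift.{1} κ < #{b : Set BinSeq // IsCofinalBranch κ T b}

/-! ### Boolean algebras of subsets of `ℕ`, ultrafilters and Stone spaces -/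

/-- `u` is an ultrafilter on the Boolean algebra `A` of subsets of `ℕ`. -/
structure IsUltrafilterOn (A : BooleanSubalgebra (Set ℕ)) (u : Set (Set ℕ)) : Prop where
  subset : ∀ a ∈ u, a ∈ A
  univ_mem : Set.univ ∈ u
  empty_notMem : ∅ ∉ u
  inter_mem : ∀ a ∈ u, ∀ b ∈ u, a ∩ b ∈ u
  mem_of_superset : ∀ a ∈ u, ∀ b ∈ A, a ⊆ b → b ∈ u
  mem_or_compl_mem : ∀ a ∈ A, a ∈ u ∨ aᶜ ∈ u

/-- The filter on `A` generated by a family `G` of subsets of `ℕ`. -/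
def filterGen (A : BooleanSubalgebra (Set ℕ)) (G : Set (Set ℕ)) : Set (Set ℕ) :=
  {a | a ∈ A ∧ ∃ F : Set (Set ℕ), F.Finite ∧ F ⊆ G ∧ ⋂₀ F ⊆ a}

/-- The Boolean algebra generated by `A` and `x`. -/
def adjoin (A : BooleanSubalgebra (Set ℕ)) (x : Set ℕ) : BooleanSubalgebra (Set ℕ) :=
  BooleanSubalgebra.closure (insert x (A : Set (Set ℕ)))

/-- `x` is minimal for `(A, u)`: `u` is the unique ultrafilter on `A` which does not generate an
ultrafilter on the Boolean algebra generated by `A` and `x`. -/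
def IsMinimalFor (x : Set ℕ) (A : BooleanSubalgebra (Set ℕ)) (u : Set (Set ℕ)) : Prop :=
  IsUltrafilterOn A u ∧ ¬ IsUltrafilterOn (adjoin A x) (filterGen (adjoin A x) u) ∧
    ∀ v : Set (Set ℕ), IsUltrafilterOn A v →
      ¬ IsUltrafilterOn (adjoin A x) (filterGen (adjoin A x) v) → v = u

/-- The Stone space of `A`: the set of all ultrafilters on `A`. -/
def StoneSpace (A : BooleanSubalgebra (Set ℕ)) : Type :=
  {u : Set (Set ℕ) // IsUltrafilterOn A u}

/-- The topology of the Stone space is generated by the sets of all ultrafilters containing `a`,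
for `a ∈ A` (these sets form a base, being closed under finite intersections). -/
instance (A : BooleanSubalgebra (Set ℕ)) : TopologicalSpace (StoneSpace A) :=
  TopologicalSpace.generateFrom {U | ∃ a ∈ A, U = {u : StoneSpace A | a ∈ u.1}}

/-! ### T-algebras -/

/-- The Boolean algebra generated by the finite subsets of `ℕ` and the sets `a s`, `s ∈ S`. -/
def algGen (a : BinSeq → Set ℕ) (S : Set BinSeq) : BooleanSubalgebra (Set ℕ) :=
  BooleanSubalgebra.closure ({x | x.Finite} ∪ a '' S)

/-- The filter on `algGen a S` generated by the cofinite sets and the sets `a s`, `s ∈ S`. -/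
def ultGen (a : BinSeq → Set ℕ) (S : Set BinSeq) : Set (Set ℕ) :=
  filterGen (algGen a S) ({x | xᶜ.Finite} ∪ a '' S)

/-- The family `(a t)`, `t ∈ T`, is a labelling of the tree `T` which defines a `T`-algebra.
All Boolean algebras contain the finite sets. A family is centered if all its finite subfamilies
have infinite intersection; the filter `ultGen a {s ∈ T | s < t}` is then automatically an
ultrafilter. -/
structure IsTLabelling (T : Set BinSeq) (a : BinSeq → Set ℕ) : Prop where
  empty : a BinSeq.empty = Set.univ
  infinite : ∀ t ∈ T, (a t).Infinite
  compl : ∀ t : BinSeq, t.snoc false ∈ T → t.snoc true ∈ T →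
    a (t.snoc true) = (a (t.snoc false))ᶜ
  centered : ∀ t ∈ T, ∀ F : Set BinSeq, F.Finite → F ⊆ {s ∈ T | s < t} →
    (⋂ s ∈ F, a s).Infinite
  minimal : ∀ t ∈ T, t ≠ BinSeq.empty →
    IsMinimalFor (a t) (algGen a {s ∈ T | s < t}) (ultGen a {s ∈ T | s < t})

/-- `A` is a `T`-algebra. -/
def IsTAlgebra (T : Set BinSeq) (A : BooleanSubalgebra (Set ℕ)) : Prop :=
  ∃ a : BinSeq → Set ℕ, IsTLabelling T a ∧ A = algGen a T

/-! ### The principle `◇⁺(κ)` -/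

/-- The principle `◇⁺(κ)` for a regular uncountable cardinal `κ`: there are families
`S α` of subsets of `α`, for `α < κ`, with `|S α| ≤ |α| + ℵ₀`, such that for every `X ⊆ κ` there
is a closed unbounded `C ⊆ κ` with `X ∩ α ∈ S α` and `C ∩ α ∈ S α` for all `α ∈ C`. -/
def DiamondPlus (κ : Cardinal.{0}) : Prop :=
  κ.IsRegular ∧ ℵ₀ < κ ∧
    ∃ S : Ordinal.{0} → Set (Set Ordinal.{0}),
      (∀ α < κ.ord, (∀ P ∈ S α, P ⊆ Iio α) ∧
        #(S α) ≤ max (Cardinal.lift.{1} α.card) ℵ₀) ∧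
      ∀ X ⊆ Iio κ.ord, ∃ C ⊆ Iio κ.ord,
        IsClub {α : Iio κ.ord | (α : Ordinal.{0}) ∈ C} ∧
        ∀ α ∈ C, X ∩ Iio α ∈ S α ∧ C ∩ Iio α ∈ S α

end TAlg

namespace TAlg

open Set Cardinal Filter

/-! ### Initial segments of binary sequences -/

namespace BinSeq

/-! For sequential compactness, subsequences are replaced by countably generated filters on the
index set. A filter along which every member of the algebra is eventually in or eventually out of
the ultrafilters yields a limit. If a filter leaves something undecided and no isolated point is met
frequently, take a shortest node `t` with undecided label: the limit on the algebra below `t` is an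
ultrafilter that `a t` splits, so minimality forces it to be the branch ultrafilter
(`exists_undecided_node`). If every filter left something undecided, refining along both sides of
each splitting node would give a Cantor scheme of filters and nodes. Countable generation survives ω
steps, so each f ∈ 2^ω also gets a node above its branch (`exists_filter_le_decided`). Cutting these
nodes at the suprema of their branches gives 𝔠 different sequences of only countably many lengths,
each length being a limit of lengths from the countable scheme. By König's theorem, countably many
levels of size < 𝔠 have fewer than 𝔠 nodes, a contradiction (`not_exists_cantor_scheme`).

The Stone space is large because cofinal branches carry centered label families, and two branches
that split contain complementary labels (`lt_mk_stoneSpace`).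

For the second claim, ◇⁺ assigns a club to each X ⊆ κ. Either there are more than κ different clubs,
and these form a Kurepa family, or some club serves more than κ sets X, and these do. Such a family
is turned into a tree by characteristic functions (`isAcceptableKurepa_familyTree`). -/

theorem eq_of_le_of_len_le {s t : BinSeq} (h : s ≤ t) (h' : t.len ≤ s.len) : s = t :=
  le_antisymm h ⟨h', fun α hα => (h.2 α (hα.trans_le h')).symm⟩

theorem len_lt_of_lt {s t : BinSeq} (h : s < t) : s.len < t.len :=
  lt_of_not_ge fun h' => h.ne (eq_of_le_of_len_le h.le h')

theorem lt_of_le_of_len_lt {s t : BinSeq} (h : s ≤ t) (h' : s.len < t.len) : s < t :=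
  lt_of_le_of_ne h fun e => h'.ne (congrArg len e)

/-- Initial segments of the same sequence are comparable. -/
theorem le_of_le_of_le {r s t : BinSeq} (hr : r ≤ t) (hs : s ≤ t) (h : r.len ≤ s.len) : r ≤ s :=
  ⟨h, fun α hα => (hr.2 α hα).trans (hs.2 α (hα.trans_le h)).symm⟩

theorem total_of_le {r s t : BinSeq} (hr : r ≤ t) (hs : s ≤ t) : r ≤ s ∨ s ≤ r :=
  (le_total r.len s.len).imp (le_of_le_of_le hr hs) (le_of_le_of_le hs hr)

theorem empty_le (t : BinSeq) : empty ≤ t :=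
  ⟨zero_le, fun _ hα => absurd hα (not_lt_of_ge zero_le)⟩

theorem ne_empty_of_len_eq {t : BinSeq} {α : Ordinal.{0}} (h : t.len = α + 1) : t ≠ empty := by
  rintro rfl
  exact (Order.succ_ne_bot α) h.symm

open Classical in
/-- The initial segment of `t` of length `min α t.len`. -/
noncomputable def restrict (t : BinSeq) (α : Ordinal.{0}) : BinSeq where
  len := min α t.len
  val := fun β => if β < α then t.val β else false
  val_of_le := fun β hβ => by
    split_ifs with h
    · exact t.val_of_le β ((min_le_iff.1 hβ).resolve_left (not_le_of_gt h))
    · rfl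

theorem restrict_len {t : BinSeq} {α : Ordinal.{0}} (h : α ≤ t.len) : (t.restrict α).len = α :=
  min_eq_left h

theorem restrict_val {t : BinSeq} {α β : Ordinal.{0}} (h : β < α) :
    (t.restrict α).val β = t.val β := if_pos h

theorem restrict_le (t : BinSeq) (α : Ordinal.{0}) : t.restrict α ≤ t :=
  ⟨min_le_right _ _, fun _ hβ => restrict_val (hβ.trans_le (min_le_left _ _))⟩

@[simp]
theorem snoc_len (t : BinSeq) (i : Bool) : (t.snoc i).len = t.len + 1 := rfl

theorem snoc_val_len (t : BinSeq) (i : Bool) : (t.snoc i).val t.len = i := if_pos rfl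

theorem snoc_val_of_lt (t : BinSeq) (i : Bool) {α : Ordinal.{0}} (h : α < t.len) :
    (t.snoc i).val α = t.val α := if_neg h.ne

theorem lt_snoc (t : BinSeq) (i : Bool) : t < t.snoc i :=
  lt_of_le_of_len_lt ⟨Order.le_succ _, fun _ hα => (snoc_val_of_lt t i hα).symm⟩ (Order.lt_succ _)

theorem snoc_ne_empty (t : BinSeq) (i : Bool) : t.snoc i ≠ empty := ne_empty_of_len_eq rfl

theorem snoc_le_of_lt {s t : BinSeq} (h : s < t) : s.snoc (t.val s.len) ≤ t := by
  refine ⟨Order.succ_le_of_lt (len_lt_of_lt h), fun α hα => ?_⟩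
  rcases (Order.lt_succ_iff.1 hα).lt_or_eq with h' | rfl
  · rw [snoc_val_of_lt _ _ h', h.le.2 α h']
  · rw [snoc_val_len]

theorem le_of_lt_snoc {s t : BinSeq} {i : Bool} (h : s < t.snoc i) : s ≤ t :=
  le_of_le_of_le h.le (lt_snoc t i).le (Order.lt_succ_iff.1 (len_lt_of_lt h))

theorem eq_snoc {t : BinSeq} {α : Ordinal.{0}} (h : t.len = α + 1) :
    ∃ p : BinSeq, ∃ i, t = p.snoc i := by
  have hα : α < t.len := h ▸ Order.lt_succ α
  have hl := restrict_len hα.le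
  have hlt : t.restrict α < t := lt_of_le_of_len_lt (restrict_le t α) (hl.symm ▸ hα)
  refine ⟨t.restrict α, t.val (t.restrict α).len, (eq_of_le_of_len_le (snoc_le_of_lt hlt) ?_).symm⟩
  rw [snoc_len, hl, h]

/-- Two incomparable sequences split at some node. -/
theorem exists_split {s t : BinSeq} (h : ¬ s ≤ t) (h' : ¬ t ≤ s) :
    ∃ r : BinSeq, ∃ i, r.snoc i ≤ s ∧ r.snoc (!i) ≤ t := by
  have hne : ∃ α, α < s.len ∧ α < t.len ∧ s.val α ≠ t.val α := by
    by_contra! H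
    rcases le_total s.len t.len with hl | hl
    · exact h ⟨hl, fun α hα => H α hα (hα.trans_le hl)⟩
    · exact h' ⟨hl, fun α hα => (H α (hα.trans_le hl) hα).symm⟩
  obtain ⟨α, ⟨hs, ht, hα⟩, hmin⟩ := WellFounded.has_min (wellFounded_lt (α := Ordinal.{0})) _ hne
  have hls := restrict_len hs.le
  have hrs : s.restrict α < s := lt_of_le_of_len_lt (restrict_le s α) (hls.symm ▸ hs)
  have hrt : s.restrict α < t := by
    refine lt_of_le_of_len_lt ⟨hls.symm ▸ ht.le, fun β hβ => ?_⟩ (hls.symm ▸ ht)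
    rw [hls] at hβ
    rw [restrict_val hβ]
    by_contra hc
    exact hmin β ⟨hβ.trans hs, hβ.trans ht, hc⟩ hβ
  refine ⟨s.restrict α, s.val α, ?_, ?_⟩
  · simpa only [hls] using snoc_le_of_lt hrs
  · have : (!s.val α) = t.val α := by
      revert hα; cases s.val α <;> cases t.val α <;> simp
    rw [this]
    simpa only [hls] using snoc_le_of_lt hrt

end BinSeq

namespace IsAcceptable

variable {κ : Cardinal.{0}} {T : Set BinSeq}

theorem mem_of_snoc_le (hT : IsAcceptable κ T) {r s : BinSeq} {i : Bool} (hs : s ∈ T)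
    (h : r.snoc i ≤ s) : r.snoc i ∈ T :=
  hT.initial_mem s hs _ h ⟨_, rfl⟩

theorem snoc_mem (hT : IsAcceptable κ T) {r : BinSeq} {i : Bool} (h : r.snoc i ∈ T) (j : Bool) :
    r.snoc j ∈ T := by
  have := hT.snoc_mem_iff r
  cases i <;> cases j <;> simp_all

theorem eq_snoc (hT : IsAcceptable κ T) {t : BinSeq} (ht : t ∈ T) (h : t ≠ BinSeq.empty) :
    ∃ p : BinSeq, ∃ i, t = p.snoc i := by
  obtain ⟨α, hα⟩ := hT.len_succ t ht h
  exact BinSeq.eq_snoc hα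

end IsAcceptable

/-- A node below a member of a branch belongs to the branch. -/
theorem IsBranch.mem_of_le {T b : Set BinSeq} (hb : IsBranch T b) {r s : BinSeq} (hs : s ∈ b)
    (hr : r ∈ T) (h : r ≤ s) : r ∈ b := by
  have hc : insert r b ⊆ T ∧ IsChain (· ≤ ·) (insert r b) := by
    refine ⟨insert_subset hr hb.prop.1, hb.prop.2.insert fun x hx _ => ?_⟩
    rcases hb.prop.2.total hs hx with h' | h'
    · exact Or.inl (h.trans h')
    · exact BinSeq.total_of_le h h'
  exact hb.le_of_ge hc (subset_insert r b) (mem_insert r b)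

/-! ### Ultrafilters and convergence in Stone spaces -/

namespace IsUltrafilterOn

variable {A : BooleanSubalgebra (Set ℕ)} {u : Set (Set ℕ)}

theorem compl_mem_iff (hu : IsUltrafilterOn A u) {a : Set ℕ} (ha : a ∈ A) : aᶜ ∈ u ↔ a ∉ u := by
  refine ⟨fun h h' => hu.empty_notMem ?_, fun h => (hu.mem_or_compl_mem a ha).resolve_left h⟩
  have := hu.inter_mem a h' _ h
  rwa [inter_compl_self] at this

theorem inter_mem_iff (hu : IsUltrafilterOn A u) {a b : Set ℕ} (ha : a ∈ A) (hb : b ∈ A) :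
    a ∩ b ∈ u ↔ a ∈ u ∧ b ∈ u :=
  ⟨fun h => ⟨hu.mem_of_superset _ h a ha inter_subset_left,
    hu.mem_of_superset _ h b hb inter_subset_right⟩, fun h => hu.inter_mem a h.1 b h.2⟩

/-- An ultrafilter without singletons has no finite members. -/
theorem notMem_of_finite (hu : IsUltrafilterOn A u) (hA : ∀ x : Set ℕ, x.Finite → x ∈ A)
    {x : Set ℕ} (hx : x.Finite) (h : ∀ k ∈ x, {k} ∉ u) : x ∉ u := by
  induction x, hx using Set.Finite.induction_on with
  | empty => exact hu.empty_notMem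
  | @insert k x hk hx ih =>
    intro hm
    have h1 := (hu.compl_mem_iff (hA _ (finite_singleton k))).2 (h k (mem_insert k x))
    refine ih (fun j hj => h j (mem_insert_of_mem k hj))
      (hu.mem_of_superset _ (hu.inter_mem _ hm _ h1) x (hA x hx) ?_)
    rintro j ⟨hj | hj, hj'⟩
    · exact absurd hj hj'
    · exact hj

/-- The restriction of an ultrafilter on `ℕ` to a Boolean algebra. -/
theorem ofUltrafilter (A : BooleanSubalgebra (Set ℕ)) (U : Ultrafilter ℕ) :
    IsUltrafilterOn A {a | a ∈ A ∧ a ∈ U} where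
  subset := fun _ h => h.1
  univ_mem := ⟨BooleanSubalgebra.top_mem, Filter.univ_mem⟩
  empty_notMem := fun h => _root_.Ultrafilter.empty_notMem h.2
  inter_mem := fun _ ha _ hb => ⟨A.infClosed ha.1 hb.1, Filter.inter_mem ha.2 hb.2⟩
  mem_of_superset := fun _ ha _ hb h => ⟨hb, Filter.mem_of_superset ha.2 h⟩
  mem_or_compl_mem := fun a ha => (U.mem_or_compl_mem a).imp (fun h => ⟨ha, h⟩)
    fun h => ⟨A.compl_mem' ha, h⟩

end IsUltrafilterOn

section Convergence

variable {ι : Type*} {A B : BooleanSubalgebra (Set ℕ)} {y : ι → Set (Set ℕ)} {l : Filter ι}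

/-- The members of `A` which are eventually in or eventually out of the ultrafilters `y`. -/
def decided (hy : ∀ n, IsUltrafilterOn A (y n)) (l : Filter ι) : BooleanSubalgebra (Set ℕ) where
  carrier := {a | a ∈ A ∧ ((∀ᶠ n in l, a ∈ y n) ∨ ∀ᶠ n in l, aᶜ ∈ y n)}
  bot_mem' := ⟨A.bot_mem', Or.inr (Eventually.of_forall fun n => by
    simpa using (hy n).univ_mem)⟩
  compl_mem' := fun {a} h => ⟨A.compl_mem' h.1, by simpa only [compl_compl] using h.2.symm⟩
  infClosed' := fun a ha b hb => by
    refine ⟨A.infClosed ha.1 hb.1, ?_⟩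
    rcases ha.2 with h | h
    · rcases hb.2 with h' | h'
      · exact Or.inl ((h.and h').mono fun n hn => (hy n).inter_mem _ hn.1 _ hn.2)
      · exact Or.inr (h'.mono fun n hn => (hy n).mem_of_superset _ hn _
          (A.compl_mem' (A.infClosed ha.1 hb.1)) (compl_subset_compl.2 inter_subset_right))
    · exact Or.inr (h.mono fun n hn => (hy n).mem_of_superset _ hn _
          (A.compl_mem' (A.infClosed ha.1 hb.1)) (compl_subset_compl.2 inter_subset_left))
  supClosed' := fun a ha b hb => by
    have hab : a ∪ b ∈ A := A.supClosed ha.1 hb.1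
    refine ⟨hab, ?_⟩
    rcases ha.2 with h | h
    · exact Or.inl (h.mono fun n hn => (hy n).mem_of_superset _ hn _ hab subset_union_left)
    · rcases hb.2 with h' | h'
      · exact Or.inl (h'.mono fun n hn => (hy n).mem_of_superset _ hn _ hab subset_union_right)
      · refine Or.inr ((h.and h').mono fun n hn => ?_)
        have := (hy n).inter_mem _ hn.1 _ hn.2
        rwa [← compl_union] at this

theorem mem_decided {hy : ∀ n, IsUltrafilterOn A (y n)} {a : Set ℕ} :
    a ∈ decided hy l ↔ a ∈ A ∧ ((∀ᶠ n in l, a ∈ y n) ∨ ∀ᶠ n in l, aᶜ ∈ y n) := Iff.rfl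

/-- If all members of `B` are decided, the limit of the ultrafilters is an ultrafilter on `B`. -/
theorem isUltrafilterOn_limit [l.NeBot] (hy : ∀ n, IsUltrafilterOn A (y n))
    (hB : B ≤ decided hy l) : IsUltrafilterOn B {a | a ∈ B ∧ ∀ᶠ n in l, a ∈ y n} where
  subset := fun _ h => h.1
  univ_mem := ⟨BooleanSubalgebra.top_mem, Eventually.of_forall fun n => (hy n).univ_mem⟩
  empty_notMem := fun h => by
    obtain ⟨n, hn⟩ := h.2.exists
    exact (hy n).empty_notMem hn
  inter_mem := fun a ha b hb => ⟨B.infClosed ha.1 hb.1,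
    (ha.2.and hb.2).mono fun n hn => (hy n).inter_mem a hn.1 b hn.2⟩
  mem_of_superset := fun a ha b hb h => ⟨hb,
    ha.2.mono fun n hn => (hy n).mem_of_superset a hn b (hB hb).1 h⟩
  mem_or_compl_mem := fun a ha => (hB ha).2.imp (fun h => ⟨ha, h⟩) fun h => ⟨B.compl_mem' ha, h⟩

theorem exists_tendsto_of_le_decided [l.NeBot] {x : ι → StoneSpace A}
    (h : A ≤ decided (fun n => (x n).2) l) : ∃ z, Tendsto x l (nhds z) := by
  refine ⟨⟨_, isUltrafilterOn_limit _ h⟩, TopologicalSpace.tendsto_nhds_generateFrom_iff.2 ?_⟩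
  rintro _ ⟨a, -, rfl⟩ hz
  exact hz.2

end Convergence

/-- A countable base allows a sequence of indices to converge to the filter; below `atTop` it can be
thinned to a strictly increasing one. -/
theorem exists_subseq_tendsto {X : Type*} [TopologicalSpace X] {x : ℕ → X} {l : Filter ℕ}
    [l.NeBot] [l.IsCountablyGenerated] (hl : l ≤ atTop) {z : X} (h : Tendsto x l (nhds z)) :
    ∃ φ : ℕ → ℕ, StrictMono φ ∧ Tendsto (x ∘ φ) atTop (nhds z) := by
  obtain ⟨v, hv⟩ := exists_seq_tendsto l
  obtain ⟨φ, hφ, hφ'⟩ := strictMono_subseq_of_tendsto_atTop (hv.mono_right hl)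
  exact ⟨v ∘ φ, hφ', h.comp (hv.comp hφ.tendsto_atTop)⟩

/-! ### The undecided nodes of a `T`-algebra -/

section Labelling

variable {T : Set BinSeq} {a : BinSeq → Set ℕ}

theorem finite_mem_algGen (S : Set BinSeq) {x : Set ℕ} (hx : x.Finite) : x ∈ algGen a S :=
  BooleanSubalgebra.subset_closure (Or.inl hx)

theorem label_mem_algGen {S : Set BinSeq} {s : BinSeq} (hs : s ∈ S) : a s ∈ algGen a S :=
  BooleanSubalgebra.subset_closure (Or.inr (mem_image_of_mem a hs))

theorem algGen_le {S : Set BinSeq} {B : BooleanSubalgebra (Set ℕ)}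
    (hB : ∀ x : Set ℕ, x.Finite → x ∈ B) (h : ∀ s ∈ S, a s ∈ B) : algGen a S ≤ B := by
  refine BooleanSubalgebra.closure_le.2 ?_
  rintro x (hx | ⟨s, hs, rfl⟩)
  · exact hB x hx
  · exact h s hs

theorem sInter_mem_of_finite {A : BooleanSubalgebra (Set ℕ)} {u : Set (Set ℕ)}
    (hu : IsUltrafilterOn A u) {G : Set (Set ℕ)} (hG : G.Finite) (h : G ⊆ u) : ⋂₀ G ∈ u := by
  induction G, hG using Set.Finite.induction_on with
  | empty => simpa using hu.univ_mem
  | @insert b G hb hG ih =>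
    rw [sInter_insert]
    exact hu.inter_mem _ (h (mem_insert b G)) _ (ih ((subset_insert b G).trans h))

/-- If the ultrafilters `y` are not all decided along the free filter `l`, then there is a node
which splits them, while they are eventually in the filter of the branch below the node. -/
theorem exists_undecided_node {ι : Type*} (hTa : IsTLabelling T a) {y : ι → Set (Set ℕ)}
    (hy : ∀ n, IsUltrafilterOn (algGen a T) (y n)) {l : Filter ι} [l.NeBot]
    (hfree : ∀ k : ℕ, ∀ᶠ n in l, {k} ∉ y n) (h : ¬ algGen a T ≤ decided hy l) :
    ∃ t ∈ T, t ≠ BinSeq.empty ∧ (∀ s ∈ T, s < t → ∀ᶠ n in l, a s ∈ y n) ∧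
      (∃ᶠ n in l, a t ∈ y n) ∧ ∃ᶠ n in l, (a t)ᶜ ∈ y n := by
  have hfin : ∀ x : Set ℕ, x.Finite → ∀ᶠ n in l, xᶜ ∈ y n := fun x hx => by
    refine (hx.eventually_all.2 fun k _ => hfree k).mono fun n hn => ?_
    have hA : ∀ z : Set ℕ, z.Finite → z ∈ algGen a T := fun z hz => finite_mem_algGen T hz
    exact ((hy n).compl_mem_iff (hA x hx)).2 ((hy n).notMem_of_finite hA hx hn)
  have hfin' : ∀ x : Set ℕ, x.Finite → x ∈ decided hy l := fun x hx =>
    ⟨finite_mem_algGen T hx, Or.inr (hfin x hx)⟩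
  have hne : ({t | t ∈ T ∧ a t ∉ decided hy l} : Set BinSeq).Nonempty := by
    by_contra hne
    rw [not_nonempty_iff_eq_empty] at hne
    refine h (algGen_le hfin' fun s hs => ?_)
    by_contra hs'
    exact (hne ▸ (show s ∈ {t | t ∈ T ∧ a t ∉ decided hy l} from ⟨hs, hs'⟩) : s ∈ (∅ : Set BinSeq))
  obtain ⟨t, ⟨htT, ht⟩, hmin⟩ :=
    (InvImage.wf BinSeq.len (wellFounded_lt (α := Ordinal.{0}))).has_min _ hne
  have htA : a t ∈ algGen a T := label_mem_algGen htT
  have hfreq : (∃ᶠ n in l, a t ∈ y n) ∧ ∃ᶠ n in l, (a t)ᶜ ∈ y n := by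
    rw [mem_decided] at ht
    push Not at ht
    obtain ⟨h1, h2⟩ := ht htA
    refine ⟨h2.mono fun n hn => ?_, h1.mono fun n hn => ((hy n).compl_mem_iff htA).2 hn⟩
    by_contra hc
    exact hn (((hy n).compl_mem_iff htA).2 hc)
  have hte : t ≠ BinSeq.empty := by
    rintro rfl
    rw [hTa.empty] at hfreq
    obtain ⟨n, hn⟩ := hfreq.2.exists
    rw [compl_univ] at hn
    exact (hy n).empty_notMem hn
  refine ⟨t, htT, hte, ?_, hfreq⟩
  -- By minimality of the length of `t`, all labels below it are decided, so `y` has a limit on the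
  -- algebra they generate.
  have hle : algGen a {s ∈ T | s < t} ≤ decided hy l := algGen_le hfin' fun s hs => by
    by_contra hs'
    exact hmin s ⟨hs.1, hs'⟩ (BinSeq.len_lt_of_lt hs.2)
  have hv := isUltrafilterOn_limit hy hle
  -- If the limit generated an ultrafilter after adjoining `a t`, then `a t` or its complement would
  -- contain a finite intersection of members of the limit, and `a t` would be decided.
  have hvu := (hTa.minimal t htT hte).2.2 _ hv fun hgen => by
    have hmem : a t ∈ adjoin (algGen a {s ∈ T | s < t}) (a t) :=
      BooleanSubalgebra.subset_closure (mem_insert _ _)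
    have key : ∀ b ∈ algGen a T, b ∈ filterGen (adjoin (algGen a {s ∈ T | s < t}) (a t))
        {a_1 | a_1 ∈ algGen a {s ∈ T | s < t} ∧ ∀ᶠ n in l, a_1 ∈ y n} →
        ∀ᶠ n in l, b ∈ y n := by
      rintro b hb ⟨-, G, hG, hGsub, hGb⟩
      exact (sInter_mem_of_finite hv hG hGsub).2.mono fun n hn =>
        (hy n).mem_of_superset _ hn b hb hGb
    exact ht ⟨htA, (hgen.mem_or_compl_mem _ hmem).imp (key _ htA)
      (key _ ((algGen a T).compl_mem' htA))⟩
  intro s hs hst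
  have hsu : a s ∈ ultGen a {s ∈ T | s < t} :=
    ⟨label_mem_algGen ⟨hs, hst⟩, {a s}, finite_singleton _,
      singleton_subset_iff.2 (Or.inr (mem_image_of_mem a ⟨hs, hst⟩)), by simp⟩
  rw [← hvu] at hsu
  exact hsu.2

end Labelling

/-! ### Cantor schemes in Kurepa trees -/

/-- The list of the first `n` values of `f`, the last one first. -/
def initialValues (f : ℕ → Bool) : ℕ → List Bool
  | 0 => []
  | n + 1 => f n :: initialValues f n

theorem initialValues_congr {f g : ℕ → Bool} {n : ℕ} (h : ∀ k < n, f k = g k) :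
    initialValues f n = initialValues g n := by
  induction n with
  | zero => rfl
  | succ n ih =>
    rw [initialValues, initialValues, h n n.lt_succ_self, ih fun k hk => h k (hk.trans n.lt_succ_self)]

/-- A countable set of ordinals has only countably many limit points. -/
theorem countable_of_forall_between {S D : Set Ordinal.{0}} (hD : D.Countable)
    (hSD : ∀ β ∈ S, ∃ d ∈ D, β ≤ d) (h : ∀ β ∈ S, ∀ α < β, ∃ d ∈ D, α ≤ d ∧ d < β) :
    S.Countable := by
  have hmem : ∀ β ∈ S, sInf {d | d ∈ D ∧ β ≤ d} ∈ {d | d ∈ D ∧ β ≤ d} := fun β hβ =>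
    csInf_mem (hSD β hβ)
  -- Sending β to the least element of D that is ≥ β is strictly increasing on S, since some element
  -- of D lies in [α, β).
  have hlt : ∀ α ∈ S, ∀ β ∈ S, α < β → sInf {d | d ∈ D ∧ α ≤ d} < sInf {d | d ∈ D ∧ β ≤ d} := by
    intro α hα β hβ hαβ
    obtain ⟨d, hd, hαd, hdβ⟩ := h β hβ α hαβ
    exact ((csInf_le' (show d ∈ {d | d ∈ D ∧ α ≤ d} from ⟨hd, hαd⟩)).trans_lt hdβ).trans_le
      (hmem β hβ).2
  refine MapsTo.countable_of_injOn (f := fun β => sInf {d | d ∈ D ∧ β ≤ d}) (t := D)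
    (fun β hβ => (hmem β hβ).1) (fun α hα β hβ e => ?_) hD
  rcases lt_trichotomy α β with hlt' | rfl | hlt'
  · exact absurd e (hlt α hα β hβ hlt').ne
  · rfl
  · exact absurd e (hlt β hβ α hα hlt').ne'

/-- In a tree of height `𝔠` with levels of size `< 𝔠`, countably many levels have together
fewer than `𝔠` nodes. -/
theorem mk_countable_levels_lt {K : Set BinSeq}
    (hK : ∀ α < continuum.ord, #{t : BinSeq // t ∈ K ∧ t.len = α} < Cardinal.lift.{1} continuum.{0})
    {S : Set Ordinal.{0}} (hS : S.Countable) (hSc : S ⊆ Iio continuum.ord) :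
    #{t : BinSeq // t ∈ K ∧ t.len ∈ S} < Cardinal.lift.{1} continuum.{0} := by
  have : Countable S := hS
  obtain ⟨e, he⟩ := exists_injective_nat S
  have hsub : {t : BinSeq | t ∈ K ∧ t.len ∈ S} ⊆
      ⋃ n : ULift.{1} ℕ, {t : BinSeq | t ∈ K ∧ ∃ h : t.len ∈ S, e ⟨t.len, h⟩ = n.down} :=
    fun t ht => mem_iUnion.2 ⟨⟨e ⟨t.len, ht.2⟩⟩, ht.1, ht.2, rfl⟩
  have hlt : ∀ n : ULift.{1} ℕ,
      #{t : BinSeq | t ∈ K ∧ ∃ h : t.len ∈ S, e ⟨t.len, h⟩ = n.down} <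
        Cardinal.lift.{1} continuum.{0} := by
    intro n
    by_cases hn : ∃ α : S, e α = n.down
    · obtain ⟨α, hα⟩ := hn
      refine (mk_le_mk_of_subset ?_).trans_lt (hK α (hSc α.2))
      rintro t ⟨htK, ht, hte⟩
      exact ⟨htK, congrArg Subtype.val (he (hte.trans hα.symm))⟩
    · rw [mk_eq_zero_iff.2]
      · simp [continuum_pos]
      · exact ⟨fun t => hn ⟨_, t.2.2.2⟩⟩
  calc _ ≤ _ := mk_le_mk_of_subset hsub
    _ ≤ _ := mk_iUnion_le_sum_mk
    -- König's theorem, followed by 𝔠^ℵ₀ = 𝔠.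
    _ < _ := sum_lt_prod _ _ hlt
    _ = _ := by simp [prod_const]

/-- A Cantor scheme of nodes cannot be continued to a node above each branch of the scheme. -/
theorem not_exists_cantor_scheme {K : Set BinSeq} (hK : IsAcceptableKurepa continuum K)
    (p : List Bool → BinSeq) (q : (ℕ → Bool) → BinSeq) (hq : ∀ f, (q f).snoc false ∈ K)
    (hp : ∀ f n, (p (initialValues f n)).snoc (f n) ≤ p (initialValues f (n + 1)))
    (hpq : ∀ f n, (p (initialValues f n)).snoc (f n) ≤ q f) : False := by
  have hT := hK.acceptable
  have hqlt : ∀ f, (q f).len < continuum.ord := fun f =>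
    (Order.lt_succ _).trans (hT.len_lt _ (hq f))
  let b : (ℕ → Bool) → Ordinal.{0} := fun f => ⨆ n, (p (initialValues f n)).len
  have hpb : ∀ f n, (p (initialValues f n)).len < b f := fun f n =>
    (Order.succ_le_iff.1 (hp f n).1).trans_le
      (Ordinal.le_iSup (fun n => (p (initialValues f n)).len) (n + 1))
  have hbq : ∀ f, b f ≤ (q f).len := fun f =>
    Ordinal.iSup_le fun n => (Order.le_succ _).trans (hpq f n).1
  let r : (ℕ → Bool) → BinSeq := fun f => (q f).restrict (b f)
  have hrlen : ∀ f, (r f).len = b f := fun f => BinSeq.restrict_len (hbq f)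
  have hpr : ∀ f n, (p (initialValues f n)).snoc (f n) ≤ r f := fun f n =>
    BinSeq.le_of_le_of_le (hpq f n) (BinSeq.restrict_le _ _)
      ((hrlen f).symm ▸ Order.succ_le_of_lt (hpb f n))
  have hrK : ∀ f, (r f).snoc false ∈ K := fun f =>
    hT.snoc_mem (hT.mem_of_snoc_le (hq f) (BinSeq.snoc_le_of_lt
      ((BinSeq.restrict_le _ _).trans_lt (BinSeq.lt_snoc _ _)))) false
  have hinj : Function.Injective r := by
    intro f g hfg
    by_contra hne
    -- At the first disagreement of f and g the scheme node is still common, and `r f`, `r g`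
    -- continue it with different digits.
    obtain ⟨n, hn, hmin⟩ := WellFounded.has_min (wellFounded_lt (α := ℕ)) {n | f n ≠ g n}
      (Function.ne_iff.1 hne)
    have hinit : initialValues f n = initialValues g n :=
      initialValues_congr fun k hk => not_not.1 fun h => hmin k h hk
    have h1 := hpr f n
    have h2 := hpr g n
    rw [← hfg, ← hinit] at h2
    apply hn
    have e1 := h1.2 _ (Order.lt_succ (p (initialValues f n)).len)
    have e2 := h2.2 _ (Order.lt_succ (p (initialValues f n)).len)
    rw [BinSeq.snoc_val_len] at e1 e2
    exact e1.trans e2.symm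
  have hcount : (range b).Countable := by
    -- Each `b f` is a limit of lengths of scheme nodes; 𝔠 is added to D only as an upper bound.
    refine countable_of_forall_between
      (D := insert continuum.ord (range fun σ => (p σ).len)) ((countable_range _).insert _) ?_ ?_
    · rintro _ ⟨f, rfl⟩
      exact ⟨_, mem_insert _ _, (hbq f).trans (hqlt f).le⟩
    · rintro _ ⟨f, rfl⟩ α hα
      obtain ⟨n, hn⟩ := Ordinal.lt_iSup_iff.1 hα
      exact ⟨_, mem_insert_of_mem _ (mem_range_self (initialValues f n)), hn.le, hpb f n⟩
  -- The sequence `r f` has limit length, so it is not itself a node; its successors are, hence the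
  -- shift by one.
  have hlt := mk_countable_levels_lt hK.level_lt (hcount.image fun β => β + 1) (by
    rintro _ ⟨_, ⟨f, rfl⟩, rfl⟩
    exact (isSuccLimit_ord aleph0_le_continuum).succ_lt ((hbq f).trans_lt (hqlt f)))
  refine hlt.not_ge ?_
  have hle : Cardinal.lift.{1} #(ℕ → Bool) ≤ Cardinal.lift.{0}
      #{t : BinSeq // t ∈ K ∧ t.len ∈ (fun β => β + 1) '' range b} := by
    refine lift_mk_le_lift_mk_of_injective (f := fun f =>
      ⟨(r f).snoc false, hrK f, b f, ⟨f, rfl⟩, congrArg (· + 1) (hrlen f).symm⟩) ?_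
    · intro f g h
      have h' : (r f).snoc false = (r g).snoc false := congrArg Subtype.val h
      have hl : (r f).len = (r g).len := Order.succ_injective (congrArg BinSeq.len h')
      refine hinj (BinSeq.eq_of_le_of_len_le
        (BinSeq.le_of_le_of_le (t := (r g).snoc false) ?_ (BinSeq.lt_snoc _ _).le hl.le) hl.ge)
      rw [← h']
      exact (BinSeq.lt_snoc _ _).le
  simpa using hle

/-! ### Splitting nodes -/

section Splitting

variable {κ : Cardinal.{0}} {T : Set BinSeq} {a : BinSeq → Set ℕ}

theorem IsTLabelling.compl_snoc (hTa : IsTLabelling T a) (hT : IsAcceptable κ T) {p : BinSeq}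
    {i : Bool} (h : p.snoc i ∈ T) : a (p.snoc (!i)) = (a (p.snoc i))ᶜ := by
  have := hTa.compl p (hT.snoc_mem h _) (hT.snoc_mem h _)
  cases i
  · exact this
  · rw [this, compl_compl]; rfl

/-- The ultrafilters `y` converge along `l` to the filter of the branch below `p`, and they are
split by the two successors of `p`. -/
structure IsSplittingNode {ι : Type*} (T : Set BinSeq) (a : BinSeq → Set ℕ) (y : ι → Set (Set ℕ))
    (l : Filter ι) (p : BinSeq) : Prop where
  snoc_mem : ∀ i, p.snoc i ∈ T
  eventually : ∀ s ∈ T, s ≤ p → ∀ᶠ n in l, a s ∈ y n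
  frequently : ∀ i, ∃ᶠ n in l, a (p.snoc i) ∈ y n

variable {ι : Type*} {y : ι → Set (Set ℕ)} {l : Filter ι}

/-- An undecided node is one of two siblings with complementary labels, so both siblings are met
frequently and their common predecessor splits. -/
theorem exists_isSplittingNode (hTa : IsTLabelling T a) (hT : IsAcceptable κ T)
    (hy : ∀ n, IsUltrafilterOn (algGen a T) (y n)) [l.NeBot]
    (hfree : ∀ k : ℕ, ∀ᶠ n in l, {k} ∉ y n) (h : ¬ algGen a T ≤ decided hy l) :
    ∃ p, IsSplittingNode T a y l p := by
  obtain ⟨t, ht, hte, hev, h1, h2⟩ := exists_undecided_node hTa hy hfree h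
  obtain ⟨p, i, rfl⟩ := hT.eq_snoc ht hte
  refine ⟨p, hT.snoc_mem ht, fun s hs hsp => hev s hs (hsp.trans_lt (BinSeq.lt_snoc p i)),
    fun j => ?_⟩
  rw [← hTa.compl_snoc hT ht] at h2
  rcases Bool.eq_or_eq_not j i with rfl | rfl
  · exact h1
  · exact h2

/-- A node all whose initial segments are eventually in `y` lies below every splitting node. -/
theorem IsSplittingNode.le_of_eventually (hTa : IsTLabelling T a) (hT : IsAcceptable κ T)
    (hy : ∀ n, IsUltrafilterOn (algGen a T) (y n)) [l.NeBot] {p s : BinSeq}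
    (hp : IsSplittingNode T a y l p) (hs : s ∈ T)
    (h : ∀ r ∈ T, r ≤ s → ∀ᶠ n in l, a r ∈ y n) : s ≤ p := by
  -- A label just off the path to `s` is the complement of one on the path, so it cannot be met
  -- frequently.
  have key : ∀ (r : BinSeq) (i : Bool), r.snoc i ≤ s → ¬ ∃ᶠ n in l, a (r.snoc (!i)) ∈ y n := by
    intro r i hr hf
    have hrT := hT.mem_of_snoc_le hs hr
    obtain ⟨n, hn, hn'⟩ := (hf.and_eventually (h _ hrT hr)).exists
    rw [hTa.compl_snoc hT hrT, (hy n).compl_mem_iff (label_mem_algGen hrT)] at hn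
    exact hn hn'
  by_contra hsp
  by_cases hps : p ≤ s
  · exact key p _ (BinSeq.snoc_le_of_lt (lt_of_le_of_ne hps fun e => hsp e.ge)) (hp.frequently _)
  · obtain ⟨r, i, h1, h2⟩ := BinSeq.exists_split hsp hps
    exact key r i h1 (hp.eventually _ (hT.snoc_mem (hT.mem_of_snoc_le hs h1) _) h2).frequently

/-- Along `l'` all labels up to `p.snoc i` are eventually met: those up to `p` because `l'` refines
`l`, the last one by the choice of side. -/
theorem IsSplittingNode.snoc_le (hTa : IsTLabelling T a) (hT : IsAcceptable κ T)
    (hy : ∀ n, IsUltrafilterOn (algGen a T) (y n)) {l' : Filter ι} [l'.NeBot] {p p' : BinSeq}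
    (hp : IsSplittingNode T a y l p) (hp' : IsSplittingNode T a y l' p') {i : Bool}
    (hl : l' ≤ l ⊓ 𝓟 {n | a (p.snoc i) ∈ y n}) : p.snoc i ≤ p' := by
  refine hp'.le_of_eventually hTa hT hy (hp.snoc_mem i) fun r hr hri => ?_
  rcases hri.eq_or_lt with rfl | hlt
  · exact hl.trans inf_le_right (mem_principal_self _)
  · exact hl.trans inf_le_left (hp.eventually r hr (BinSeq.le_of_lt_snoc hlt))

end Splitting

/-! ### The Stone space of a `K`-algebra -/

section Kurepa

variable {K : Set BinSeq} {a : BinSeq → Set ℕ}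

/-- A sequence of ultrafilters on a `K`-algebra which does not meet any isolated point frequently
is decided along some filter with a countable base. -/
theorem exists_filter_le_decided (hK : IsAcceptableKurepa continuum K) (hKa : IsTLabelling K a)
    {y : ℕ → Set (Set ℕ)} (hy : ∀ n, IsUltrafilterOn (algGen a K) (y n))
    (hfree : ∀ k : ℕ, ∀ᶠ n in atTop, {k} ∉ y n) :
    ∃ l : Filter ℕ, l.NeBot ∧ l.IsCountablyGenerated ∧ l ≤ atTop ∧ algGen a K ≤ decided hy l := by
  by_contra! H
  have hT := hK.acceptable
  let L := {l : Filter ℕ // l.NeBot ∧ l.IsCountablyGenerated ∧ l ≤ atTop}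
  have hL : ∀ l : L, ∃ p, IsSplittingNode K a y l.1 p := fun l =>
    have := l.2.1
    exists_isSplittingNode hKa hT hy (fun k => l.2.2.2 (hfree k)) (H l.1 l.2.1 l.2.2.1 l.2.2.2)
  choose node hnode using hL
  let step : Bool → L → L := fun i l => ⟨l.1 ⊓ 𝓟 {n | a ((node l).snoc i) ∈ y n},
    frequently_iff_neBot.1 ((hnode l).frequently i),
    have := l.2.2.1
    inferInstance, inf_le_left.trans l.2.2.2⟩
  -- Lists carry their newest digit at the head, so `foldr` applies the newest refinement last and
  -- extending a list refines its filter.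
  let scheme : List Bool → L := List.foldr step ⟨atTop, inferInstance, inferInstance, le_rfl⟩
  have hanti : ∀ f, Antitone fun n => (scheme (initialValues f n)).1 := fun f =>
    antitone_nat_of_succ_le fun n => inf_le_left
  -- A decreasing sequence of proper, countably generated filters has an infimum of the same kind,
  -- so the scheme passes through stage ω.
  let lim : (ℕ → Bool) → L := fun f => ⟨⨅ n, (scheme (initialValues f n)).1,
    iInf_neBot_of_directed' (hanti f).directed_ge fun n => (scheme (initialValues f n)).2.1,
    have := fun n => (scheme (initialValues f n)).2.2.1
    inferInstance, (iInf_le _ 0).trans (scheme (initialValues f 0)).2.2.2⟩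
  refine not_exists_cantor_scheme hK (fun σ => node (scheme σ)) (fun f => node (lim f))
    (fun f => (hnode _).snoc_mem _) (fun f n => ?_) fun f n => ?_
  · have := (scheme (initialValues f (n + 1))).2.1
    exact (hnode _).snoc_le hKa hT hy (hnode _) le_rfl
  · have := (lim f).2.1
    exact (hnode _).snoc_le hKa hT hy (hnode _)
      (iInf_le (fun n => (scheme (initialValues f n)).1) (n + 1))

theorem seqCompactSpace_stoneSpace (hK : IsAcceptableKurepa continuum K)
    (hKa : IsTLabelling K a) : SeqCompactSpace (StoneSpace (algGen a K)) := by
  refine ⟨fun x _ => ?_⟩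
  suffices h : ∃ l : Filter ℕ, l.NeBot ∧ l.IsCountablyGenerated ∧ l ≤ atTop ∧
      algGen a K ≤ decided (fun n => (x n).2) l by
    obtain ⟨l, _, _, hl, hd⟩ := h
    obtain ⟨z, hz⟩ := exists_tendsto_of_le_decided hd
    obtain ⟨φ, hφ, hφz⟩ := exists_subseq_tendsto hl hz
    exact ⟨z, mem_univ z, φ, hφ, hφz⟩
  by_cases hfree : ∀ k : ℕ, ∀ᶠ n in atTop, {k} ∉ (x n).1
  · exact exists_filter_le_decided hK hKa (fun n => (x n).2) hfree
  · push Not at hfree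
    obtain ⟨k, hk⟩ := hfree
    -- Along the indices whose ultrafilter contains `{k}`, membership of `b` is decided by whether
    -- `k ∈ b`.
    refine ⟨atTop ⊓ 𝓟 {n | {k} ∈ (x n).1}, frequently_iff_neBot.1 hk, inferInstance, inf_le_left,
      fun b hb => ⟨hb, ?_⟩⟩
    have hmem : ∀ᶠ n in atTop ⊓ 𝓟 {n | {k} ∈ (x n).1}, {k} ∈ (x n).1 :=
      mem_inf_of_right (mem_principal_self _)
    by_cases hkb : k ∈ b
    · exact Or.inl (hmem.mono fun n hn => (x n).2.mem_of_superset _ hn b hb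
        (singleton_subset_iff.2 hkb))
    · exact Or.inr (hmem.mono fun n hn => (x n).2.mem_of_superset _ hn bᶜ
        ((algGen a K).compl_mem' hb) (singleton_subset_iff.2 hkb))

/-- The Stone space of an algebra of subsets of `ℕ` is separable. -/
theorem separableSpace_stoneSpace (A : BooleanSubalgebra (Set ℕ)) :
    TopologicalSpace.SeparableSpace (StoneSpace A) := by
  let pt : ℕ → StoneSpace A := fun k =>
    ⟨_, IsUltrafilterOn.ofUltrafilter A (pure k : Ultrafilter ℕ)⟩
  have hbasis : TopologicalSpace.IsTopologicalBasis
      {U | ∃ b ∈ A, U = {u : StoneSpace A | b ∈ u.1}} := by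
    refine ⟨?_, ?_, rfl⟩
    · rintro _ ⟨b, hb, rfl⟩ _ ⟨c, hc, rfl⟩ u hu
      refine ⟨_, ⟨b ∩ c, A.infClosed hb hc, rfl⟩, (u.2.inter_mem_iff hb hc).2 hu, fun v hv => ?_⟩
      exact (v.2.inter_mem_iff hb hc).1 hv
    · exact eq_univ_of_forall fun u => ⟨_, ⟨univ, BooleanSubalgebra.top_mem, rfl⟩, u.2.univ_mem⟩
  refine ⟨range pt, countable_range pt, hbasis.dense_iff.2 ?_⟩
  rintro _ ⟨b, hb, rfl⟩ ⟨u, hu⟩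
  have hne : b.Nonempty := nonempty_iff_ne_empty.2 fun e => u.2.empty_notMem (e ▸ hu)
  obtain ⟨k, hk⟩ := hne
  exact ⟨pt k, ⟨hb, hk⟩, mem_range_self k⟩

/-- The labels of a cofinal branch belong to an ultrafilter. -/
theorem exists_ultrafilter_of_isCofinalBranch {κ : Cardinal.{0}} {T b : Set BinSeq}
    (hT : IsAcceptable κ T) (hTa : IsTLabelling T a) (hb : IsCofinalBranch κ T b) :
    ∃ U : Ultrafilter ℕ, ∀ t ∈ b, a t ∈ U := by
  have hne : (generate (a '' b)).NeBot := by
    rw [generate_neBot_iff]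
    intro G hG hGfin
    obtain ⟨F, hFb, hF, rfl⟩ := exists_subset_image_finite_and.1 ⟨G, hG, hGfin, rfl⟩
    -- Lengths in a finite subset of the branch are bounded, so it lies strictly below a single node
    -- of the branch, where centeredness applies.
    have hbd : ∃ α < κ.ord, ∀ s ∈ F, s.len ≤ α := by
      clear hG hGfin
      induction F, hF using Set.Finite.induction_on with
      | empty => exact ⟨0, hT.len_lt _ hT.empty_mem, by simp⟩
      | @insert s F _ _ ih =>
        obtain ⟨α, hα, h⟩ := ih ((subset_insert s F).trans hFb)
        refine ⟨max α s.len, max_lt hα (hT.len_lt s (hb.1.prop.1 (hFb (mem_insert s F)))), ?_⟩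
        rintro r (rfl | hr)
        · exact le_max_right _ _
        · exact (h r hr).trans (le_max_left _ _)
    obtain ⟨α, hα, h⟩ := hbd
    obtain ⟨t, ht, hαt⟩ := hb.2 α hα
    have := (hTa.centered t (hb.1.prop.1 ht) F hF fun s hs => ⟨hb.1.prop.1 (hFb hs), ?_⟩).nonempty
    · simpa only [sInter_image] using this
    · have hlt := (h s hs).trans_lt hαt
      rcases hb.1.prop.2.total (hFb hs) ht with hst | hst
      · exact BinSeq.lt_of_le_of_len_lt hst hlt
      · exact absurd hst.1 (not_le_of_gt hlt)
  obtain ⟨U, hU⟩ := Ultrafilter.exists_le (generate (a '' b))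
  exact ⟨U, fun t ht => hU (mem_generate_of_mem (mem_image_of_mem a ht))⟩

/-- Incomparable nodes of two branches would put complementary labels into the same ultrafilter.
Hence each node of one branch lies below a longer node of the other, and maximality makes the
branches equal. -/
theorem lt_mk_stoneSpace {κ : Cardinal.{0}} (hK : IsAcceptableKurepa κ K)
    (hKa : IsTLabelling K a) : κ < #(StoneSpace (algGen a K)) := by
  have hT := hK.acceptable
  choose U hU using fun b : {b : Set BinSeq // IsCofinalBranch κ K b} =>
    exists_ultrafilter_of_isCofinalBranch hT hKa b.2
  have hinj : Function.Injective fun b =>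
      (⟨_, IsUltrafilterOn.ofUltrafilter (algGen a K) (U b)⟩ : StoneSpace (algGen a K)) := by
    intro b c h
    have hsub : b.1 ⊆ c.1 := by
      intro s hs
      have hsK := b.2.1.prop.1 hs
      have hcomp : ∀ t ∈ c.1, t ≤ s ∨ s ≤ t := by
        intro t ht
        by_contra! hts
        obtain ⟨r, i, h1, h2⟩ := BinSeq.exists_split hts.2 hts.1
        have hr1 := hT.mem_of_snoc_le hsK h1
        have hr2 := hT.snoc_mem hr1 (!i)
        have hm1 := hU b _ (b.2.1.mem_of_le hs hr1 h1)
        have hm2 := hU c _ (c.2.1.mem_of_le ht hr2 h2)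
        have h3 : a (r.snoc i) ∈ {x | x ∈ algGen a K ∧ x ∈ U c} := by
          have e : {x | x ∈ algGen a K ∧ x ∈ U b} = {x | x ∈ algGen a K ∧ x ∈ U c} :=
            congrArg Subtype.val h
          exact e ▸ (show a (r.snoc i) ∈ {x | x ∈ algGen a K ∧ x ∈ U b} from
            ⟨label_mem_algGen hr1, hm1⟩)
        rw [hKa.compl_snoc hT hr1] at hm2
        exact Ultrafilter.compl_mem_iff_notMem.1 hm2 h3.2
      obtain ⟨t, ht, hlt⟩ := c.2.2 s.len (hT.len_lt s hsK)
      rcases hcomp t ht with hts | hst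
      · exact absurd hts.1 (not_le_of_gt hlt)
      · exact c.2.1.mem_of_le ht hsK hst
    exact Subtype.ext (b.2.1.eq_of_subset c.2.1.prop hsub)
  have := hK.lt_branches.trans_le (by simpa using lift_mk_le_lift_mk_of_injective hinj)
  exact lift_lt.1 this

end Kurepa

/-! ### Kurepa trees from Kurepa families and from `◇⁺` -/

section Family

variable {κ : Cardinal.{0}} {F : Set (Set Ordinal.{0})}

/-- The tree of all initial segments of characteristic functions of members of `F` followed by an
arbitrary last digit, together with the empty sequence. -/
def familyTree (κ : Cardinal.{0}) (F : Set (Set Ordinal.{0})) : Set BinSeq :=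
  {t | t = BinSeq.empty ∨ ∃ β < κ.ord, t.len = β + 1 ∧
    ∃ X ∈ F, ∀ η < β, (t.val η = true ↔ η ∈ X)}

open Classical in
/-- The characteristic function of `X`, restricted to `α`. -/
noncomputable def charSeq (X : Set Ordinal.{0}) (α : Ordinal.{0}) : BinSeq where
  len := α
  val := fun β => decide (β < α ∧ β ∈ X)
  val_of_le := fun β hβ => by simp [not_lt_of_ge hβ]

theorem charSeq_val {X : Set Ordinal.{0}} {α β : Ordinal.{0}} (h : β < α) :
    (charSeq X α).val β = true ↔ β ∈ X := by
  simp [charSeq, h]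

theorem charSeq_mono (X : Set Ordinal.{0}) {α β : Ordinal.{0}} (h : α ≤ β) :
    charSeq X α ≤ charSeq X β :=
  ⟨h, fun η (hη : η < α) => by
    rw [Bool.eq_iff_iff, charSeq_val hη, charSeq_val (lt_of_lt_of_le hη h)]⟩

theorem isAcceptable_familyTree (hκ : ℵ₀ ≤ κ) : IsAcceptable κ (familyTree κ F) where
  len_lt := by
    rintro t (rfl | ⟨β, hβ, h, -⟩)
    · exact Cardinal.ord_pos.2 (Cardinal.aleph0_pos.trans_le hκ)
    · rw [h]; exact (Cardinal.isSuccLimit_ord hκ).succ_lt hβ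
  empty_mem := Or.inl rfl
  len_succ := by
    rintro t (rfl | ⟨β, hβ, h, -⟩) hne
    · exact absurd rfl hne
    · exact ⟨β, h⟩
  initial_mem := by
    rintro s hs r hr ⟨α, hα⟩
    rcases hs with rfl | ⟨β, hβ, h, X, hX, hX'⟩
    · exact Or.inl (le_antisymm hr (BinSeq.empty_le r))
    · have hαβ : α ≤ β := by
        have := hr.1
        rw [hα, h] at this
        exact Order.succ_le_succ_iff.1 this
      refine Or.inr ⟨α, hαβ.trans_lt hβ, hα, X, hX, fun η hη => ?_⟩
      rw [hr.2 η (hα ▸ hη.trans (Order.lt_succ α))]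
      exact hX' η (hη.trans_le hαβ)
  snoc_mem_iff := by
    have key : ∀ (t : BinSeq) (i j : Bool), t.snoc i ∈ familyTree κ F → t.snoc j ∈ familyTree κ F := by
      rintro t i j (h | ⟨β, hβ, h, X, hX, hX'⟩)
      · exact absurd h (BinSeq.snoc_ne_empty t i)
      · obtain rfl : t.len = β := Order.succ_injective h
        refine Or.inr ⟨t.len, hβ, rfl, X, hX, fun η hη => ?_⟩
        rw [← hX' η hη, BinSeq.snoc_val_of_lt _ _ hη, BinSeq.snoc_val_of_lt _ _ hη]
    exact fun t => ⟨key t _ _, key t _ _⟩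

theorem charSeq_mem_familyTree {X : Set Ordinal.{0}} (hX : X ∈ F) {β : Ordinal.{0}}
    (hβ : β < κ.ord) : charSeq X (β + 1) ∈ familyTree κ F :=
  Or.inr ⟨β, hβ, rfl, X, hX, fun _ hη => charSeq_val (hη.trans (Order.lt_succ β))⟩

theorem familyTree_level_lt (hκ : ℵ₀ ≤ κ)
    (hF : ∀ α < κ.ord, #((fun X => X ∩ Iio α) '' F) < Cardinal.lift.{1} κ)
    {α : Ordinal.{0}} (hα : α < κ.ord) :
    #{t : BinSeq // t ∈ familyTree κ F ∧ t.len = α} < Cardinal.lift.{1} κ := by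
  have hκ' : ℵ₀ ≤ Cardinal.lift.{1} κ := by simpa using hκ
  by_cases h : ∃ β, α = β + 1
  · obtain ⟨β, rfl⟩ := h
    have hβ : β < κ.ord := (Order.lt_succ β).trans hα
    -- A node of length β + 1 is determined by a trace on β and its free last digit.
    let φ : {t : BinSeq // t ∈ familyTree κ F ∧ t.len = β + 1} →
        ((fun X => X ∩ Iio β) '' F) × ULift.{1} Bool := fun t =>
      ⟨⟨{η | η < β ∧ t.1.val η = true}, by
        rcases t.2.1 with h | ⟨γ, -, h, X, hX, hX'⟩
        · exact absurd h (BinSeq.ne_empty_of_len_eq t.2.2)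
        · obtain rfl : γ = β := Order.succ_injective (h.symm.trans t.2.2)
          refine ⟨X, hX, ?_⟩
          ext η
          simp only [mem_inter_iff, mem_Iio, mem_ofPred_eq]
          constructor
          · rintro ⟨h1, h2⟩; exact ⟨h2, (hX' η h2).2 h1⟩
          · rintro ⟨h1, h2⟩; exact ⟨(hX' η h1).1 h2, h1⟩⟩, ⟨t.1.val β⟩⟩
    have hφ : Function.Injective φ := by
      rintro ⟨s, hs, hsl⟩ ⟨t, ht, htl⟩ h
      simp only [φ, Prod.mk.injEq, Subtype.mk.injEq, ULift.up.injEq] at h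
      refine Subtype.ext (BinSeq.eq_of_le_of_len_le ⟨(hsl.trans htl.symm).le, fun η hη => ?_⟩
        (htl.trans hsl.symm).le)
      rcases (Order.lt_succ_iff.1 (hη.trans_le hsl.le)).lt_or_eq with h' | rfl
      · have := Set.ext_iff.1 h.1 η
        simp only [mem_ofPred_eq, h', true_and] at this
        exact Bool.eq_iff_iff.2 this
      · exact h.2
    refine (mk_le_of_injective hφ).trans_lt ?_
    rw [mk_prod, lift_id, lift_id]
    exact mul_lt_of_lt hκ' (hF β hβ) ((lt_aleph0_of_finite _).trans_le hκ')
  · refine lt_of_le_of_lt (mk_le_one_iff_set_subsingleton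
      (s := {t : BinSeq | t ∈ familyTree κ F ∧ t.len = α}).2 ?_) (one_lt_aleph0.trans_le hκ')
    have : ∀ t ∈ {t : BinSeq | t ∈ familyTree κ F ∧ t.len = α}, t = BinSeq.empty := by
      rintro t ⟨rfl | ⟨γ, -, h', -⟩, ht⟩
      · rfl
      · exact absurd ⟨γ, ht.symm.trans h'⟩ h
    intro s hs t ht
    rw [this s hs, this t ht]

/-- The branch of `familyTree κ F` which consists of the initial segments of `X`. -/
def familyBranch (κ : Cardinal.{0}) (X : Set Ordinal.{0}) : Set BinSeq :=
  {t | t = BinSeq.empty ∨ ∃ β < κ.ord, t = charSeq X (β + 1)}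

theorem isCofinalBranch_familyBranch (hκ : ℵ₀ ≤ κ) {X : Set Ordinal.{0}} (hX : X ∈ F) :
    IsCofinalBranch κ (familyTree κ F) (familyBranch κ X) := by
  have hcof : ∀ α < κ.ord, charSeq X (α + 1) ∈ familyBranch κ X := fun α hα => Or.inr ⟨α, hα, rfl⟩
  refine ⟨⟨⟨?_, ?_⟩, ?_⟩, fun α hα => ⟨_, hcof α hα, Order.lt_succ α⟩⟩
  · rintro t (rfl | ⟨β, hβ, rfl⟩)
    · exact Or.inl rfl
    · exact charSeq_mem_familyTree hX hβ
  · rintro s (rfl | ⟨β, hβ, rfl⟩) t (rfl | ⟨γ, hγ, rfl⟩) -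
    · exact Or.inl le_rfl
    · exact Or.inl (BinSeq.empty_le _)
    · exact Or.inr (BinSeq.empty_le _)
    · exact (le_total β γ).imp (fun h => charSeq_mono X (Order.succ_le_succ h))
        fun h => charSeq_mono X (Order.succ_le_succ h)
  · rintro c ⟨hcT, hc⟩ hbc t ht
    -- Compared with a longer initial segment of X in the chain, `t` must lie below it and so is an
    -- initial segment of X.
    have hlen := (isAcceptable_familyTree hκ).len_lt t (hcT ht)
    have hle : t ≤ charSeq X (t.len + 1) := by
      rcases hc.total ht (hbc (hcof _ hlen)) with h | h
      · exact h
      · exact absurd h.1 (not_le_of_gt (Order.lt_succ t.len))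
    rcases hcT ht with rfl | ⟨β, hβ, h, -⟩
    · exact Or.inl rfl
    · refine Or.inr ⟨β, hβ, BinSeq.eq_of_le_of_len_le
        (BinSeq.le_of_le_of_le hle (charSeq_mono X ?_) h.le) h.ge⟩
      rw [← h]
      exact Order.le_succ _

theorem familyBranch_injOn (hF : ∀ X ∈ F, X ⊆ Iio κ.ord) : F.InjOn (familyBranch κ) := by
  have key : ∀ X ∈ F, ∀ Y, familyBranch κ X = familyBranch κ Y → X ⊆ Y := by
    intro X hX Y h η hη
    have hm : charSeq X (η + 1) ∈ familyBranch κ Y := h ▸ Or.inr ⟨η, hF X hX hη, rfl⟩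
    rcases hm with h' | ⟨β, -, h'⟩
    · exact absurd h' (BinSeq.ne_empty_of_len_eq (α := η) rfl)
    · obtain rfl : η = β := Order.succ_injective (congrArg BinSeq.len h')
      rw [← charSeq_val (Order.lt_succ η)] at hη ⊢
      exact h' ▸ hη
  exact fun X hX Y hY h => (key X hX Y h).antisymm (key Y hY X h.symm)

/-- A family of more than `κ` subsets of `κ` with fewer than `κ` traces on each `α < κ`
yields an acceptable `κ`-Kurepa tree. -/
theorem isAcceptableKurepa_familyTree (hκ : ℵ₀ ≤ κ) (hFκ : ∀ X ∈ F, X ⊆ Iio κ.ord)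
    (hcard : Cardinal.lift.{1} κ < #F)
    (hF : ∀ α < κ.ord, #((fun X => X ∩ Iio α) '' F) < Cardinal.lift.{1} κ) :
    IsAcceptableKurepa κ (familyTree κ F) where
  acceptable := isAcceptable_familyTree hκ
  height := fun α hα => by
    have : Nonempty F := mk_ne_zero_iff.1 (zero_le.trans_lt hcard).ne'
    obtain ⟨X, hX⟩ := this
    exact ⟨_, charSeq_mem_familyTree hX hα, Order.lt_succ α⟩
  level_lt := fun α hα => familyTree_level_lt hκ hF hα
  lt_branches := hcard.trans_le <| by
    refine mk_le_of_injective (f := fun X : F => (⟨familyBranch κ X,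
      isCofinalBranch_familyBranch hκ X.2⟩ : {b // IsCofinalBranch κ (familyTree κ F) b})) ?_
    intro X Y h
    exact Subtype.ext (familyBranch_injOn hFκ X.2 Y.2 (congrArg Subtype.val h))

end Family

/-! ### Kurepa families from `◇⁺` -/

/-- The trace on `α` of a set `C` which is closed below `α` is empty, or the trace of `C` on
some `γ ∈ C`, possibly with `γ` added. -/
theorem trace_of_isClub {κ : Cardinal.{0}} {C : Set Ordinal.{0}} (hCκ : C ⊆ Iio κ.ord)
    (hC : IsClub {α : Iio κ.ord | (α : Ordinal.{0}) ∈ C}) {α : Ordinal.{0}} (hα : α < κ.ord) :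
    C ∩ Iio α = ∅ ∨ ∃ γ ∈ C, γ ≤ α ∧
      (C ∩ Iio α = C ∩ Iio γ ∨ C ∩ Iio α = insert γ (C ∩ Iio γ)) := by
  rcases (C ∩ Iio α).eq_empty_or_nonempty with he | hne
  · exact Or.inl he
  right
  have hbdd : BddAbove (C ∩ Iio α) := ⟨α, fun x hx => hx.2.le⟩
  have hlub : IsLUB (C ∩ Iio α) (sSup (C ∩ Iio α)) := isLUB_csSup hne hbdd
  have hle : sSup (C ∩ Iio α) ≤ α := hlub.2 fun x hx => hx.2.le
  set γ := sSup (C ∩ Iio α) with hγ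
  -- The supremum of the trace belongs to C by closedness.
  have hγC : γ ∈ C := by
    let d : Set (Iio κ.ord) := {x | (x : Ordinal.{0}) ∈ C ∩ Iio α}
    have hd : IsLUB d ⟨γ, hle.trans_lt hα⟩ := by
      refine ⟨fun x hx => hlub.1 hx, fun x hx => hlub.2 fun z hz => ?_⟩
      exact hx (a := ⟨z, hCκ hz.1⟩) hz
    obtain ⟨z, hz⟩ := hne
    exact hC.isLUB_mem (t := d) (fun x hx => hx.1) ⟨⟨z, hCκ hz.1⟩, hz⟩ hd
  refine ⟨γ, hγC, hle, ?_⟩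
  by_cases hm : γ < α
  · right
    ext x
    simp only [mem_inter_iff, mem_Iio, mem_insert_iff]
    constructor
    · rintro ⟨h1, h2⟩
      exact (hlub.1 ⟨h1, h2⟩).eq_or_lt.imp id fun h => ⟨h1, h⟩
    · rintro (rfl | ⟨h1, h2⟩)
      · exact ⟨hγC, hm⟩
      · exact ⟨h1, h2.trans_le hle⟩
  · left
    rw [le_antisymm hle (not_lt.1 hm)]

theorem exists_isAcceptableKurepa_of_diamondPlus {κ : Cardinal.{0}} (h : DiamondPlus κ) :
    ∃ K : Set BinSeq, IsAcceptableKurepa κ K := by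
  obtain ⟨-, hκ, S, hS, hC⟩ := h
  have hκ' : ℵ₀ ≤ Cardinal.lift.{1} κ := by simpa using hκ.le
  have hcard : ∀ α < κ.ord, max (Cardinal.lift.{1} α.card) ℵ₀ < Cardinal.lift.{1} κ := by
    intro α hα
    refine max_lt (lift_lt.2 (lt_ord.1 hα)) ?_
    simpa using hκ
  have hScard : ∀ α < κ.ord, #(S α) < Cardinal.lift.{1} κ := fun α hα =>
    (hS α hα).2.trans_lt (hcard α hα)
  choose! c hcκ hclub hcS using hC
  by_cases hcase : Cardinal.lift.{1} κ < #(c '' 𝒫 (Iio κ.ord))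
  · refine ⟨_, isAcceptableKurepa_familyTree (F := c '' 𝒫 (Iio κ.ord)) hκ.le ?_ hcase ?_⟩
    · rintro _ ⟨X, hX, rfl⟩
      exact hcκ X hX
    intro α hα
    -- All possible traces on α of the chosen clubs; the uniform bound |α| + ℵ₀ on the guesses at γ
    -- ≤ α keeps this set smaller than κ.
    let M : Set (Set Ordinal.{0}) := {∅} ∪ ⋃ γ ∈ Iic α, (S γ ∪ (insert γ) '' S γ)
    have hM : (fun X => X ∩ Iio α) '' (c '' 𝒫 (Iio κ.ord)) ⊆ M := by
      rintro _ ⟨_, ⟨X, hX, rfl⟩, rfl⟩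
      rcases trace_of_isClub (hcκ X hX) (hclub X hX) hα with h0 | ⟨γ, hγ, hγα, h1⟩
      · exact Or.inl h0
      · refine Or.inr (mem_biUnion (x := γ) hγα ?_)
        have h2 := (hcS X hX γ hγ).2
        exact h1.imp (fun h => by simpa only [h] using h2) fun h => ⟨_, h2, h.symm⟩
    refine (mk_le_mk_of_subset hM).trans_lt ((mk_union_le _ _).trans_lt
      (add_lt_of_lt hκ' ?_ (lt_of_le_of_lt (b := (max (Cardinal.lift.{1} α.card) ℵ₀ + 1) *
        (max (Cardinal.lift.{1} α.card) ℵ₀ + max (Cardinal.lift.{1} α.card) ℵ₀)) ?_ ?_)))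
    · rw [mk_singleton]
      exact one_lt_aleph0.trans_le hκ'
    · refine (mk_biUnion_le _ _).trans (mul_le_mul' ?_ (ciSup_le' fun γ => ?_))
      · rw [← Order.Iio_succ, mk_Iio_ordinal, Order.succ_eq_add_one, Ordinal.card_add,
          Ordinal.card_one, lift_add, lift_one]
        exact add_le_add (le_max_left _ _) le_rfl
      · have hγ : #(S γ) ≤ max (Cardinal.lift.{1} α.card) ℵ₀ :=
          ((hS γ (lt_of_le_of_lt γ.2 hα)).2).trans
            (max_le_max (lift_le.2 (Ordinal.card_le_card γ.2)) le_rfl)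
        exact (mk_union_le _ _).trans (add_le_add hγ (mk_image_le.trans hγ))
    · have := hcard α hα
      exact mul_lt_of_lt hκ' (add_lt_of_lt hκ' this (one_lt_aleph0.trans_le hκ'))
        (add_lt_of_lt hκ' this this)
  -- Otherwise at most κ clubs with fibres of size at most κ would cover all 2^κ subsets of κ.
  · have hfib : ∃ C ∈ c '' 𝒫 (Iio κ.ord),
        Cardinal.lift.{1} κ < #{X | X ∈ 𝒫 (Iio κ.ord) ∧ c X = C} := by
      by_contra! H
      have hcov : 𝒫 (Iio κ.ord) ⊆
          ⋃ C ∈ c '' 𝒫 (Iio κ.ord), {X | X ∈ 𝒫 (Iio κ.ord) ∧ c X = C} := fun X hX =>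
        mem_biUnion (mem_image_of_mem c hX) ⟨hX, rfl⟩
      have h1 := (mk_le_mk_of_subset hcov).trans (mk_biUnion_le _ _)
      have h2 : #(𝒫 (Iio κ.ord)) = 2 ^ Cardinal.lift.{1} κ := by
        rw [mk_powerset, mk_Iio_ordinal, card_ord]
      refine (cantor (Cardinal.lift.{1} κ)).not_ge (h2 ▸ h1.trans ?_)
      exact mul_le_of_le hκ' (not_lt.1 hcase) (ciSup_le' fun C => H C C.2)
    obtain ⟨_, ⟨Y, hY, rfl⟩, hbig⟩ := hfib
    refine ⟨_, isAcceptableKurepa_familyTree hκ.le (fun X hX => hX.1) hbig fun α hα => ?_⟩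
    -- One γ ≥ α in the common club works for the whole fibre: every trace on α is cut from a guess
    -- in `S γ`.
    obtain ⟨⟨γ, hγκ⟩, hγ, hαγ⟩ := (hclub Y hY).isCofinal ⟨α, hα⟩
    have hsub : (fun X => X ∩ Iio α) '' {X | X ∈ 𝒫 (Iio κ.ord) ∧ c X = c Y} ⊆
        (fun X => X ∩ Iio α) '' S γ := by
      rintro _ ⟨X, ⟨hX, hXY⟩, rfl⟩
      refine ⟨_, (hcS X hX γ (hXY ▸ hγ)).1, ?_⟩
      have : Iio α ⊆ Iio γ := Iio_subset_Iio hαγ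
      simp only [inter_assoc, inter_eq_self_of_subset_right this]
    exact ((mk_le_mk_of_subset hsub).trans mk_image_le).trans_lt (hScard γ hγκ)

end TAlg

theorem mainTheorem8 :
    (∀ K : Set TAlg.BinSeq, TAlg.IsAcceptableKurepa Cardinal.continuum K →
      ∀ A : BooleanSubalgebra (Set ℕ), TAlg.IsTAlgebra K A →
        SeqCompactSpace (TAlg.StoneSpace A) ∧
        TopologicalSpace.SeparableSpace (TAlg.StoneSpace A) ∧
        Cardinal.continuum < Cardinal.mk (TAlg.StoneSpace A)) ∧
    (TAlg.DiamondPlus Cardinal.continuum →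
      ∃ K : Set TAlg.BinSeq, TAlg.IsAcceptableKurepa Cardinal.continuum K) := by
  refine ⟨?_, TAlg.exists_isAcceptableKurepa_of_diamondPlus⟩
  rintro K hK _ ⟨a, ha, rfl⟩
  exact ⟨TAlg.seqCompactSpace_stoneSpace hK ha, TAlg.separableSpace_stoneSpace _,
    TAlg.lt_mk_stoneSpace hK ha⟩
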